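/- A permutation of $[n]=\{1,\dots,n\}$ ($n\ge 0$) is written in one-line notation, and any word of distinct positive integers is treated likewise, with $n$ denoting its maximum when it is written $\alpha\, n\, \beta$. Let $\mathbf S$ be the stack sorting operator, $\mathbf S(\varepsilon)=\varepsilon$, $\mathbf S(\alpha\, n\,\beta)=\mathbf S(\alpha)\,\mathbf S(\beta)\,n$, and let $\mathbf R$ be the reversal operator. A permutation $\theta$ of $[n]$ is sorted by an operator $\mathbf B$ if $\mathbf B(\theta)=1\,2\cdots n$. The in-order tree $T_{\mathrm{in}}(\theta)$ is the unique decreasing binary tree whose in-order reading is $\theta$: $T_{\mathrm{in}}(\varepsilon)$ is empty, and $T_{\mathrm{in}}(\alpha\, n\,\beta)$ has root $n$, left subtree $T_{\mathrm{in}}(\alpha)$ and right subtree $T_{\mathrm{in}}(\beta)$. Its shape is the underlying unlabeled binary tree. For permutations $\alpha$ of $[a]$ and $\beta$ of $[b]$ put $\alpha\oplus\beta=\alpha\,(\beta+a)$ and $\alpha\ominus\beta=(\alpha+b)\,\beta$. Every nonempty $231$-avoiding permutation is uniquely of the form $\alpha\oplus(1\ominus\beta)$ with $\alpha,\beta$ $231$-avoiding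 (possibly empty). Define $P$ on $231$-avoiding permutations by $P(\varepsilon)=\varepsilon$ and $P(\alpha\oplus(1\ominus\beta))=(P(\alpha)\oplus 1)\ominus P(\beta)$, and define the relabeling $\lambda_\pi$ by $P(\pi)=\lambda_\pi\circ\pi$. For a composition $\mathbf A$ of finitely many (possibly zero) operators from $\{\mathbf S,\mathbf R\}$ and a permutation $\theta$ sorted by $\mathbf S\circ\mathbf A$ (so that $\mathbf A(\theta)$ avoids $231$), put $\Phi_{\mathbf A}(\theta)=\lambda_{\mathbf A(\theta)}\circ\theta$. Theorem. Let $\mathbf A$ be any composition of operators from $\{\mathbf S,\mathbf R\}$ and let $\theta$ be a permutation of $[n]$ sorted by $\mathbf S\circ\mathbf A$. Then $\Phi_{\mathbf A}(\theta)$ is a permutation of $[n]$, and $T_{\mathrm{in}}(\Phi_{\mathbf A}(\theta))$ has the same shape as $T_{\mathrm{in}}(\theta)$. Moreover $\Phi_{\mathbf A}(\theta)$ and $\theta$ have the same number and the same positions of left-to-right maxima (entries larger than all entries to their left), the same number and the same positions of right-to-left maxima (entries larger than all entries to their right), and the same up-down word (the word $w\in\{u,d\}^{n-1}$ with $w_i=u$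 if the $i$-th entry is smaller than the $(i+1)$-st, and $w_i=d$ otherwise). -/

import Mathlib

namespace StackSort

/-- `π` is (the one-line notation of) a permutation of `{1, …, n}`. -/
def IsPermutation (n : ℕ) (π : List ℕ) : Prop :=
  π.Perm (List.range' 1 n)

/-! ### Splitting a word `α n β` at its maximum `n` -/

/-- The maximum entry of a word (`0` for the empty word). -/
def maxEntry (π : List ℕ) : ℕ :=
  π.foldr max 0

/-- The factor `α` of `π = α n β`, where `n` is the maximum entry of `π`. -/
def beforeMax (π : List ℕ) : List ℕ :=
  π.take (π.idxOf (maxEntry π))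

/-- The factor `β` of `π = α n β`, where `n` is the maximum entry of `π`. -/
def afterMax (π : List ℕ) : List ℕ :=
  π.drop (π.idxOf (maxEntry π) + 1)

theorem le_maxEntry {π : List ℕ} {x : ℕ} (hx : x ∈ π) : x ≤ maxEntry π := by
  induction π with
  | nil => simp at hx
  | cons a t ih =>
    simp only [maxEntry, List.foldr_cons, List.mem_cons] at *
    rcases hx with rfl | hx
    · exact le_max_left _ _
    · exact (ih hx).trans (le_max_right _ _)

theorem maxEntry_mem {π : List ℕ} (h : π ≠ []) : maxEntry π ∈ π := by
  induction π with
  | nil => exact absurd rfl h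
  | cons a t ih =>
    by_cases ht : t = []
    · subst ht; simp [maxEntry]
    · have := ih ht
      simp only [maxEntry, List.foldr_cons, List.mem_cons] at *
      rcases le_total a (t.foldr max 0) with h' | h'
      · right; rwa [max_eq_right h']
      · left; exact max_eq_left h'

theorem length_beforeMax_lt {π : List ℕ} (h : π ≠ []) :
    (beforeMax π).length < π.length := by
  have := List.idxOf_lt_length_iff.2 (maxEntry_mem h)
  simp only [beforeMax, List.length_take]
  omega

theorem length_afterMax_lt {π : List ℕ} (h : π ≠ []) :
    (afterMax π).length < π.length := by
  have := List.length_pos_iff.2 h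
  simp only [afterMax, List.length_drop]
  omega

theorem maxEntry_split {α β : List ℕ} {n : ℕ} (hα : ∀ x ∈ α, x < n) (hβ : ∀ x ∈ β, x < n) :
    maxEntry (α ++ n :: β) = n := by
  apply le_antisymm
  · have := maxEntry_mem (π := α ++ n :: β) (by simp)
    simp only [List.mem_append, List.mem_cons] at this
    rcases this with h | h | h
    · exact (hα _ h).le
    · exact h.le
    · exact (hβ _ h).le
  · exact le_maxEntry (by simp)

theorem idxOf_split {α β : List ℕ} {n : ℕ} (hα : ∀ x ∈ α, x < n) :
    (α ++ n :: β).idxOf n = α.length := by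
  have : n ∉ α := fun h => lt_irrefl _ (hα n h)
  rw [List.idxOf_append_of_notMem this]
  simp

theorem beforeMax_split {α β : List ℕ} {n : ℕ} (hα : ∀ x ∈ α, x < n) (hβ : ∀ x ∈ β, x < n) :
    beforeMax (α ++ n :: β) = α := by
  rw [beforeMax, maxEntry_split hα hβ, idxOf_split hα]
  simp

theorem afterMax_split {α β : List ℕ} {n : ℕ} (hα : ∀ x ∈ α, x < n) (hβ : ∀ x ∈ β, x < n) :
    afterMax (α ++ n :: β) = β := by
  rw [afterMax, maxEntry_split hα hβ, idxOf_split hα]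
  simp

theorem split_eq {π : List ℕ} (h : π ≠ []) :
    beforeMax π ++ maxEntry π :: afterMax π = π := by
  have hlt := List.idxOf_lt_length_iff.2 (maxEntry_mem h)
  have h1 : π[π.idxOf (maxEntry π)] = maxEntry π := List.getElem_idxOf hlt
  conv_rhs => rw [← List.take_append_drop (π.idxOf (maxEntry π)) π,
    List.drop_eq_getElem_cons hlt, h1]
  rfl

/-! ### The operators `S` and `R` -/

/-- The stack sorting operator: `S(ε) = ε` and `S(α n β) = S(α) S(β) n`, with `n` the maximum. -/
def stackSort : List ℕ → List ℕ
  | [] => []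
  | a :: t =>
    stackSort (beforeMax (a :: t)) ++ stackSort (afterMax (a :: t)) ++ [maxEntry (a :: t)]
termination_by π => π.length
decreasing_by
  · exact length_beforeMax_lt (by simp)
  · exact length_afterMax_lt (by simp)

theorem stackSort_nil : stackSort [] = [] := by
  rw [stackSort]

theorem stackSort_split {α β : List ℕ} {n : ℕ} (hα : ∀ x ∈ α, x < n) (hβ : ∀ x ∈ β, x < n) :
    stackSort (α ++ n :: β) = stackSort α ++ stackSort β ++ [n] := by
  have key : ∀ π : List ℕ, π ≠ [] → stackSort π =
      stackSort (beforeMax π) ++ stackSort (afterMax π) ++ [maxEntry π] := by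
    intro π hπ
    cases π with
    | nil => exact absurd rfl hπ
    | cons a t => rw [stackSort]
  rw [key _ (by simp), beforeMax_split hα hβ, afterMax_split hα hβ, maxEntry_split hα hβ]

/-- The operators which are compositions of (any number of) copies of the stack sorting operator
`S` and the reversal operator `R`. -/
inductive IsComposition : (List ℕ → List ℕ) → Prop
  | identity : IsComposition id
  | comp_stackSort {A : List ℕ → List ℕ} : IsComposition A → IsComposition (A ∘ stackSort)
  | comp_reverse {A : List ℕ → List ℕ} : IsComposition A → IsComposition (A ∘ List.reverse)

/-- `θ` is sorted by the operator `B`: the result `B(θ)` is `1 2 … n`, where `n` is the size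
of `θ`. -/
def IsSortedBy (B : List ℕ → List ℕ) (θ : List ℕ) : Prop :=
  B θ = List.range' 1 θ.length

/-! ### The bijection `P` from `Av(231)` to `Av(132)` -/

/-- The sum `α ⊕ β = α (β + a)`, where `a` is the length of `α`. -/
def directSum (α β : List ℕ) : List ℕ :=
  α ++ β.map (· + α.length)

/-- The skew sum `α ⊖ β = (α + b) β`, where `b` is the length of `β`. -/
def skewSum (α β : List ℕ) : List ℕ :=
  α.map (· + β.length) ++ β

/-- The map `P`, given by `P(ε) = ε` and `P(α ⊕ (1 ⊖ β)) = (P(α) ⊕ 1) ⊖ P(β)`. A `231`-avoiding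
permutation `π = α n γ` has this form with `β = γ - |α|`. (The values at words that are not
`231`-avoiding permutations are never used.) -/
def mapP : List ℕ → List ℕ
  | [] => []
  | a :: t =>
    skewSum (directSum (mapP (beforeMax (a :: t))) [1])
      (mapP ((afterMax (a :: t)).map (· - (beforeMax (a :: t)).length)))
termination_by π => π.length
decreasing_by
  · exact length_beforeMax_lt (by simp)
  · rw [List.length_map]; exact length_afterMax_lt (by simp)

theorem mapP_nil : mapP [] = [] := by
  rw [mapP]

theorem mapP_of_ne_nil {π : List ℕ} (h : π ≠ []) :
    mapP π = skewSum (directSum (mapP (beforeMax π)) [1])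
      (mapP ((afterMax π).map (· - (beforeMax π).length))) := by
  cases π with
  | nil => exact absurd rfl h
  | cons a t => rw [mapP]

/-- The defining recursion of `P`. -/
theorem mapP_directSum_skewSum {a b : ℕ} {α β : List ℕ}
    (hα : IsPermutation a α) (hβ : IsPermutation b β) :
    mapP (directSum α (skewSum [1] β)) = skewSum (directSum (mapP α) [1]) (mapP β) := by
  have la : α.length = a := by simpa using hα.length_eq
  have lb : β.length = b := by simpa using hβ.length_eq
  have h1 : ∀ x ∈ α, x < 1 + b + a := by
    intro x hx
    have := (hα.mem_iff).1 hx
    simp at this; omega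
  have h2 : ∀ x ∈ β.map (· + a), x < 1 + b + a := by
    intro x hx
    obtain ⟨y, hy, rfl⟩ := List.mem_map.1 hx
    have := (hβ.mem_iff).1 hy
    simp at this; omega
  have e : directSum α (skewSum [1] β) = α ++ (1 + b + a) :: β.map (· + a) := by
    simp [directSum, skewSum, la, lb]
  rw [e, mapP_of_ne_nil (by simp), beforeMax_split h1 h2, afterMax_split h1 h2, la,
    List.map_map]
  have e2 : (fun x => x - a) ∘ (fun x => x + a) = id := by
    funext x; simp
  rw [e2, List.map_id]

theorem length_mapP (π : List ℕ) : (mapP π).length = π.length := by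
  induction hn : π.length using Nat.strong_induction_on generalizing π with
  | _ k ih =>
    by_cases h : π = []
    · subst h; simp [mapP_nil, ← hn]
    · have h1 := length_beforeMax_lt h
      have h2 := length_afterMax_lt h
      have h3 := congrArg List.length (split_eq h)
      simp only [List.length_append, List.length_cons] at h3
      rw [mapP_of_ne_nil h]
      have e1 := ih _ (hn ▸ h1) (beforeMax π) rfl
      have e2 := ih _ (hn ▸ h2) ((afterMax π).map (· - (beforeMax π).length)) (by simp)
      simp only [skewSum, directSum, List.length_append, List.length_map, e1, e2,
        List.length_cons, List.length_nil]
      omega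

/-- The relabelling `λ_π` of the values of `π`: it sends the entry `π(i)` to `P(π)(i)`. -/
def relabel (π : List ℕ) (v : ℕ) : ℕ :=
  (mapP π).getD (π.idxOf v) 0

/-- The defining property `P(π) = λ_π ∘ π`. -/
theorem map_relabel {π : List ℕ} (h : π.Nodup) : π.map (relabel π) = mapP π := by
  apply List.ext_getElem
  · simp [length_mapP]
  · intro i h1 h2
    simp only [List.length_map] at h1
    simp [relabel, h.idxOf_getElem, h2]

/-- The map `Φ_A : θ ↦ λ_{A(θ)} ∘ θ`, used for `θ` sorted by `S ∘ A`. -/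
def Phi (A : List ℕ → List ℕ) (θ : List ℕ) : List ℕ :=
  θ.map (relabel (A θ))

/-! ### In-order trees -/

/-- The in-order reading of a labelled binary tree. -/
def inorder : BinaryTree ℕ → List ℕ
  | .nil => []
  | .node n l r => inorder l ++ n :: inorder r

/-- The label of `c` (if there is one) is smaller than `n`. -/
def RootLT (n : ℕ) : BinaryTree ℕ → Prop
  | .nil => True
  | .node a _ _ => a < n

/-- A tree is decreasing if every child has a smaller label than its parent. -/
def IsDecreasing : BinaryTree ℕ → Prop
  | .nil => True
  | .node n l r => RootLT n l ∧ RootLT n r ∧ IsDecreasing l ∧ IsDecreasing r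

/-- The in-order tree of a permutation: `T_in(ε)` is empty, and `T_in(α n β)`, with `n` the maximum,
has root `n`, left subtree `T_in(α)` and right subtree `T_in(β)`. -/
def inTree : List ℕ → BinaryTree ℕ
  | [] => .nil
  | a :: t =>
    .node (maxEntry (a :: t)) (inTree (beforeMax (a :: t))) (inTree (afterMax (a :: t)))
termination_by π => π.length
decreasing_by
  · exact length_beforeMax_lt (by simp)
  · exact length_afterMax_lt (by simp)

theorem inTree_nil : inTree [] = .nil := by
  rw [inTree]

theorem inTree_of_ne_nil {π : List ℕ} (h : π ≠ []) :
    inTree π = .node (maxEntry π) (inTree (beforeMax π)) (inTree (afterMax π)) := by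
  cases π with
  | nil => exact absurd rfl h
  | cons a t => rw [inTree]

theorem inTree_split {α β : List ℕ} {n : ℕ} (hα : ∀ x ∈ α, x < n) (hβ : ∀ x ∈ β, x < n) :
    inTree (α ++ n :: β) = .node n (inTree α) (inTree β) := by
  rw [inTree_of_ne_nil (by simp), beforeMax_split hα hβ, afterMax_split hα hβ,
    maxEntry_split hα hβ]

theorem inorder_inTree (π : List ℕ) : inorder (inTree π) = π := by
  induction hn : π.length using Nat.strong_induction_on generalizing π with
  | _ k ih =>
    by_cases h : π = []
    · subst h; simp [inTree_nil, inorder]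
    · rw [inTree_of_ne_nil h, inorder, ih _ (hn ▸ length_beforeMax_lt h) _ rfl,
        ih _ (hn ▸ length_afterMax_lt h) _ rfl, split_eq h]

theorem rootLT_of_forall {n : ℕ} {T : BinaryTree ℕ} (h : ∀ x ∈ inorder T, x < n) : RootLT n T := by
  cases T with
  | nil => trivial
  | node a l r => exact h a (by simp [inorder])

theorem forall_of_rootLT {n : ℕ} {T : BinaryTree ℕ} (hd : IsDecreasing T) (h : RootLT n T) :
    ∀ x ∈ inorder T, x < n := by
  induction T generalizing n with
  | nil => simp [inorder]
  | node a l r ihl ihr =>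
    obtain ⟨h1, h2, h3, h4⟩ := hd
    have han : a < n := h
    intro x hx
    simp only [inorder, List.mem_append, List.mem_cons] at hx
    rcases hx with hx | rfl | hx
    · exact (ihl h3 h1 x hx).trans han
    · exact han
    · exact (ihr h4 h2 x hx).trans han

theorem isDecreasing_inTree {π : List ℕ} (hπ : π.Nodup) : IsDecreasing (inTree π) := by
  induction hn : π.length using Nat.strong_induction_on generalizing π with
  | _ k ih =>
    by_cases h : π = []
    · subst h; rw [inTree_nil]; trivial
    · have hs := split_eq h
      have hnd : (beforeMax π ++ maxEntry π :: afterMax π).Nodup := hs.symm ▸ hπ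
      have hle : ∀ x ∈ beforeMax π ++ maxEntry π :: afterMax π, x ≤ maxEntry π := by
        intro x hx
        rw [hs] at hx
        exact le_maxEntry hx
      rw [List.nodup_append] at hnd
      obtain ⟨n1, n2, n3⟩ := hnd
      rw [List.nodup_cons] at n2
      rw [inTree_of_ne_nil h]
      refine ⟨rootLT_of_forall ?_, rootLT_of_forall ?_,
        ih _ (hn ▸ length_beforeMax_lt h) n1 rfl, ih _ (hn ▸ length_afterMax_lt h) n2.2 rfl⟩
      · intro x hx
        rw [inorder_inTree] at hx
        exact lt_of_le_of_ne (hle x (by simp [hx])) (n3 x hx _ (by simp))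
      · intro x hx
        rw [inorder_inTree] at hx
        exact lt_of_le_of_ne (hle x (by simp [hx])) (fun e => n2.1 (e ▸ hx))

/-- `T_in(π)` is the unique decreasing binary tree whose in-order reading is `π`. -/
theorem isDecreasing_and_inorder_iff {π : List ℕ} (hπ : π.Nodup) (T : BinaryTree ℕ) :
    IsDecreasing T ∧ inorder T = π ↔ T = inTree π := by
  constructor
  · rintro ⟨hd, rfl⟩
    clear hπ
    induction T with
    | nil => rw [inorder, inTree_nil]
    | node a l r ihl ihr =>
      obtain ⟨h1, h2, h3, h4⟩ := hd
      rw [inorder, inTree_split (forall_of_rootLT h3 h1) (forall_of_rootLT h4 h2), ← ihl h3,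
        ← ihr h4]
  · rintro rfl
    exact ⟨isDecreasing_inTree hπ, inorder_inTree π⟩

/-- The shape of a labelled binary tree: the underlying unlabelled binary tree. -/
def shape (T : BinaryTree ℕ) : BinaryTree Unit :=
  T.map fun _ => ()

/-! ### Statistics -/

/-- The positions (counted from `0`) of the left-to-right maxima of `π`. -/
def lrMaxPositions (π : List ℕ) : Finset ℕ :=
  {i ∈ Finset.range π.length | ∀ j < i, π.getD j 0 < π.getD i 0}

/-- The positions (counted from `0`) of the right-to-left maxima of `π`. -/
def rlMaxPositions (π : List ℕ) : Finset ℕ :=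
  {i ∈ Finset.range π.length | ∀ j < π.length, i < j → π.getD j 0 < π.getD i 0}

/-- The letters `u` and `d`. -/
inductive UpDown
  | u
  | d

/-- The up-down word of `π`, with `i`-th letter `u` if `π(i) < π(i+1)` and `d` otherwise. -/
def upDownWord (π : List ℕ) : List UpDown :=
  List.zipWith (fun a b => if a < b then UpDown.u else UpDown.d) π π.tail

end StackSort

namespace StackSort

/-! The in-order tree of a word records where the maximum of each subtree's factor sits, so its
shape survives a relabelling `f` as soon as `f` sends the maximum of every factor to the maximum of
the relabelled factor. This is `RespectsMax`, and left-to-right maxima, right-to-left maxima and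
ascents are all read off from such maxima.

The property pulls back along both operators. For `R` this is symmetry. For `S`, each subtree of `π`
with reading `α n β` contributes to `S(π)` the factor `S(α) S(β) n` with the same letters and
maximum, so what is known on `S(π)` yields it on `π` (`RespectsMax.of_stackSort`). Hence it suffices
to treat the stack-sortable word `A(θ)`. There `P(α ⊕ (1 ⊖ β)) = (P(α) ⊕ 1) ⊖ P(β)` keeps the
maximum in place and recurses on both sides (`respectsMax_of_map_eq_mapP`). -/

/-- The relabelling `f` preserves the strict maximum of every factor of `π`. -/
def RespectsMax (f : ℕ → ℕ) (π : List ℕ) : Prop :=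
  ∀ α y β, (α ++ y :: β) <:+: π → (∀ x ∈ α, x < y) → (∀ x ∈ β, x < y) →
    (∀ x ∈ α, f x < f y) ∧ ∀ x ∈ β, f x < f y

theorem RespectsMax.of_infix {f : ℕ → ℕ} {σ π : List ℕ} (h : RespectsMax f π) (hσ : σ <:+: π) :
    RespectsMax f σ :=
  fun α y β hw => h α y β (hw.trans hσ)

theorem RespectsMax.reverse {f : ℕ → ℕ} {π : List ℕ} (h : RespectsMax f π) :
    RespectsMax f π.reverse := by
  intro α y β hw hα hβ
  have hw' : (β.reverse ++ y :: α.reverse) <:+: π := by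
    have := List.reverse_infix.2 hw
    simpa using this
  have := h _ _ _ hw' (by simpa using hβ) (by simpa using hα)
  simpa using this.symm

theorem respectsMax_nil (f : ℕ → ℕ) : RespectsMax f [] := by
  intro α y β hw
  simp at hw

/-- A factor of `α n β` avoiding `n` is a factor of `α` or of `β`. -/
theorem infix_of_infix_split {α β w : List ℕ} {n : ℕ} (h : w <:+: α ++ n :: β) (hn : n ∉ w) :
    w <:+: α ∨ w <:+: β := by
  obtain ⟨u, v, e⟩ := h
  rw [List.append_assoc, List.append_eq_append_iff] at e
  rcases e with ⟨s, e1, e2⟩ | ⟨s, e1, e2⟩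
  · rw [List.append_eq_append_iff] at e2
    rcases e2 with ⟨t, e3, e4⟩ | ⟨t, e3, e4⟩
    · exact Or.inl ⟨u, t, by simp [e1, e3]⟩
    · rcases t with _ | ⟨c, t⟩
      · exact Or.inl ⟨u, [], by simp [e1, e3]⟩
      · simp only [List.cons_append, List.cons.injEq] at e4
        exact absurd (by simp [e3, e4.1]) hn
  · rcases s with _ | ⟨c, s⟩
    · simp only [List.nil_append] at e2
      rcases w with _ | ⟨c, w⟩
      · exact Or.inl List.nil_infix
      · simp only [List.cons_append, List.cons.injEq] at e2
        exact absurd (by simp [e2.1]) hn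
    · simp only [List.cons_append, List.cons.injEq] at e2
      exact Or.inr ⟨s, v, by simp [e2.2]⟩

/-- A factor containing `n` can only have `n` as its strict maximum, and comparisons with `n` are
assumed; any other factor lies inside `α` or `β`. -/
theorem respectsMax_split {f : ℕ → ℕ} {α β : List ℕ} {n : ℕ}
    (hα : ∀ x ∈ α, x < n) (hβ : ∀ x ∈ β, x < n)
    (dα : RespectsMax f α) (dβ : RespectsMax f β)
    (fα : ∀ x ∈ α, f x < f n) (fβ : ∀ x ∈ β, f x < f n) : RespectsMax f (α ++ n :: β) := by
  intro a y b hw ha hb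
  by_cases hn : n ∈ a ++ y :: b
  · have hsub := hw.subset
    have hy : y = n := by
      have h1 : n ≤ y := by
        simp only [List.mem_append, List.mem_cons] at hn
        rcases hn with h | h | h
        · exact (ha n h).le
        · exact h.le
        · exact (hb n h).le
      have h2 : y ∈ α ++ n :: β := hsub (by simp)
      simp only [List.mem_append, List.mem_cons] at h2
      rcases h2 with h | h | h
      · have := hα y h; omega
      · exact h
      · have := hβ y h; omega
    subst hy
    have key : ∀ x ∈ a ++ y :: b, x < y → f x < f y := by
      intro x hx hxy
      have := hsub hx
      simp only [List.mem_append, List.mem_cons] at this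
      rcases this with h | h | h
      · exact fα x h
      · omega
      · exact fβ x h
    exact ⟨fun x hx => key x (by simp [hx]) (ha x hx),
      fun x hx => key x (by simp [hx]) (hb x hx)⟩
  · rcases infix_of_infix_split hw hn with h | h
    · exact dα a y b h ha hb
    · exact dβ a y b h ha hb

/-- Induction on words of distinct letters along the decomposition `α n β` at the maximum. -/
theorem split_induction {p : List ℕ → Prop} (nil : p [])
    (split : ∀ α n β, (∀ x ∈ α, x < n) → (∀ x ∈ β, x < n) → p α → p β → p (α ++ n :: β))
    {π : List ℕ} (hπ : π.Nodup) : p π := by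
  induction hn : π.length using Nat.strong_induction_on generalizing π with
  | _ k ih =>
    by_cases h : π = []
    · exact h ▸ nil
    · have hs := split_eq h
      have hd : (beforeMax π ++ maxEntry π :: afterMax π).Nodup := hs.symm ▸ hπ
      have hle : ∀ x ∈ beforeMax π ++ maxEntry π :: afterMax π, x ≤ maxEntry π :=
        fun x hx => le_maxEntry (hs ▸ hx)
      obtain ⟨n1, n2, n3⟩ := List.nodup_append.1 hd
      have n4 := List.nodup_cons.1 n2
      rw [← hs]
      exact split _ _ _
        (fun x hx => lt_of_le_of_ne (hle x (by simp [hx])) (n3 x hx _ (by simp)))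
        (fun x hx => lt_of_le_of_ne (hle x (by simp [hx])) (fun e => n4.1 (e ▸ hx)))
        (ih _ (hn ▸ length_beforeMax_lt h) n1 rfl)
        (ih _ (hn ▸ length_afterMax_lt h) n4.2 rfl)

/-! ### Pulling `RespectsMax` back along `S` and `R` -/

theorem stackSort_perm {π : List ℕ} (hπ : π.Nodup) : (stackSort π).Perm π := by
  refine split_induction (p := fun π => (stackSort π).Perm π) (by simp [stackSort_nil]) ?_ hπ
  intro α n β hα hβ pα pβ
  rw [stackSort_split hα hβ, List.append_assoc]
  exact pα.append ((List.perm_append_singleton n _).trans (pβ.cons n))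

/-- `S(α)` and `S(β)` are factors of `S(α) S(β) n`, which handles the two sides by induction; the
whole word, with maximum `n`, compares every letter with `n`. -/
theorem RespectsMax.of_stackSort {f : ℕ → ℕ} {π : List ℕ} (hπ : π.Nodup)
    (h : RespectsMax f (stackSort π)) : RespectsMax f π := by
  -- `split_induction` does not hand distinctness to the pieces, so the motive carries it.
  have key : π.Nodup → RespectsMax f (stackSort π) → RespectsMax f π := by
    refine split_induction
      (p := fun π => π.Nodup → RespectsMax f (stackSort π) → RespectsMax f π)
      (fun _ _ => respectsMax_nil f) ?_ hπ
    intro α n β hα hβ dα dβ nd h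
    have nα : α.Nodup := nd.of_append_left
    have nβ : β.Nodup := (List.nodup_cons.1 nd.of_append_right).2
    have pα := stackSort_perm nα
    have pβ := stackSort_perm nβ
    rw [stackSort_split hα hβ] at h
    have hlt : ∀ x ∈ stackSort α ++ stackSort β, x < n := by
      intro x hx
      rcases List.mem_append.1 hx with hx | hx
      · exact hα x (pα.mem_iff.1 hx)
      · exact hβ x (pβ.mem_iff.1 hx)
    have hf := (h _ n [] List.infix_rfl hlt (by simp)).1
    refine respectsMax_split hα hβ
      (dα nα (h.of_infix ⟨[], stackSort β ++ [n], by simp⟩))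
      (dβ nβ (h.of_infix ⟨stackSort α, [n], by simp⟩)) ?_ ?_
    · exact fun x hx => hf x (List.mem_append_left _ (pα.mem_iff.2 hx))
    · exact fun x hx => hf x (List.mem_append_right _ (pβ.mem_iff.2 hx))
  exact key hπ h

theorem IsComposition.perm {A : List ℕ → List ℕ} (hA : IsComposition A) :
    ∀ {π : List ℕ}, π.Nodup → (A π).Perm π := by
  induction hA with
  | identity => exact fun _ => List.Perm.refl _
  | comp_stackSort _ ih =>
    exact fun hπ => (ih ((stackSort_perm hπ).nodup_iff.2 hπ)).trans (stackSort_perm hπ)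
  | comp_reverse _ ih =>
    exact fun {π} hπ => (ih (List.nodup_reverse.2 hπ)).trans π.reverse_perm

theorem RespectsMax.of_isComposition {f : ℕ → ℕ} {A : List ℕ → List ℕ} (hA : IsComposition A) :
    ∀ {π : List ℕ}, π.Nodup → RespectsMax f (A π) → RespectsMax f π := by
  induction hA with
  | identity => exact fun _ h => h
  | comp_stackSort _ ih =>
    exact fun hπ h => .of_stackSort hπ (ih ((stackSort_perm hπ).nodup_iff.2 hπ) h)
  | comp_reverse _ ih =>
    intro π hπ h
    simpa using (ih (List.nodup_reverse.2 hπ) h).reverse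

/-! ### The relabelling `λ_π` -/

theorem isPermutation_skewSum {a b : ℕ} {α β : List ℕ} (hα : IsPermutation a α)
    (hβ : IsPermutation b β) : IsPermutation (b + a) (skewSum α β) := by
  have lb : β.length = b := by simpa using hβ.length_eq
  have e : (List.range' 1 a).map (· + b) = List.range' (1 + b) a := by
    rw [add_comm 1, ← List.map_add_range']
    simp only [add_comm]
  rw [IsPermutation, skewSum, ← List.range'_append_1, lb, ← e]
  exact List.perm_append_comm.trans (hβ.append (hα.map _))

theorem isPermutation_directSum_one {a : ℕ} {α : List ℕ} (hα : IsPermutation a α) :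
    IsPermutation (a + 1) (directSum α [1]) := by
  have la : α.length = a := by simpa using hα.length_eq
  rw [IsPermutation, directSum, ← List.range'_append_1, la]
  exact hα.append (by simp)

/-- No pattern avoidance is needed: the values of `mapP` are built from lengths alone, the letters
serving only to locate the maxima. -/
theorem isPermutation_mapP (π : List ℕ) : IsPermutation π.length (mapP π) := by
  induction hn : π.length using Nat.strong_induction_on generalizing π with
  | _ k ih =>
    by_cases h : π = []
    · subst h; subst hn; simp [mapP_nil, IsPermutation]
    · have h1 := ih _ (hn ▸ length_beforeMax_lt h) (beforeMax π) rfl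
      have h2 := ih _ (hn ▸ length_afterMax_lt h)
        ((afterMax π).map (· - (beforeMax π).length)) (by simp)
      have h3 := congrArg List.length (split_eq h)
      simp only [List.length_append, List.length_cons] at h3
      have := isPermutation_skewSum (isPermutation_directSum_one h1) h2
      rw [mapP_of_ne_nil h]
      convert this using 1
      omega

theorem IsPermutation.le {n x : ℕ} {π : List ℕ} (h : IsPermutation n π) (hx : x ∈ π) :
    x ≤ n := by
  have := h.mem_iff.1 hx
  simp at this
  omega

theorem stackSort_map_add (a : ℕ) {π : List ℕ} (hπ : π.Nodup) :
    stackSort (π.map (· + a)) = (stackSort π).map (· + a) := by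
  refine split_induction (p := fun π => stackSort (π.map (· + a)) = (stackSort π).map (· + a))
    (by simp [stackSort_nil]) ?_ hπ
  intro α n β hα hβ eα eβ
  rw [stackSort_split hα hβ, List.map_append, List.map_cons, stackSort_split, eα, eβ]
  · simp
  · simpa using hα
  · simpa using hβ

theorem RespectsMax.of_map_add {f : ℕ → ℕ} {a : ℕ} {π : List ℕ}
    (h : RespectsMax (fun x => f (x + a)) π) : RespectsMax f (π.map (· + a)) := by
  rintro α y β ⟨u, v, e⟩ hα hβ
  obtain ⟨w, v', rfl, e1, rfl⟩ := List.map_eq_append_iff.1 e.symm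
  obtain ⟨u', w', rfl, rfl, e2⟩ := List.map_eq_append_iff.1 e1
  obtain ⟨α', w'', rfl, rfl, e3⟩ := List.map_eq_append_iff.1 e2
  obtain ⟨y', β', rfl, rfl, rfl⟩ := List.map_eq_cons_iff.1 e3
  have := h α' y' β' ⟨u', v', rfl⟩ (by simpa using hα) (by simpa using hβ)
  simpa using this

theorem mapP_split {α β : List ℕ} {n : ℕ} (hα : ∀ x ∈ α, x < n) (hβ : ∀ x ∈ β, x < n) :
    mapP (α ++ n :: β) = (mapP α).map (· + β.length) ++ (α.length + 1 + β.length) ::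
      mapP (β.map (· - α.length)) := by
  rw [mapP_of_ne_nil (by simp), beforeMax_split hα hβ, afterMax_split hα hβ]
  simp [skewSum, directSum, length_mapP, add_comm, add_left_comm]

/-- Any relabelling that turns a stack-sortable `π` into `P(π)` respects maxima. -/
theorem respectsMax_of_map_eq_mapP {f : ℕ → ℕ} {π : List ℕ} (hπ : π.Nodup)
    (hs : stackSort π = List.range' 1 π.length) (hf : π.map f = mapP π) : RespectsMax f π := by
  induction hn : π.length using Nat.strong_induction_on generalizing π f with
  | _ k ih =>
  by_cases h : π = []
  · exact h ▸ respectsMax_nil f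
  obtain ⟨α, n, β, hα, hβ, rfl⟩ :
      ∃ α n β, (∀ x ∈ α, x < n) ∧ (∀ x ∈ β, x < n) ∧ π = α ++ n :: β := by
    have := split_induction (p := fun π => π ≠ [] → ∃ α n β, (∀ x ∈ α, x < n) ∧
      (∀ x ∈ β, x < n) ∧ π = α ++ n :: β) (fun h => absurd rfl h)
      (fun α n β hα hβ _ _ _ => ⟨α, n, β, hα, hβ, rfl⟩) hπ
    exact this h
  have nα : α.Nodup := hπ.of_append_left
  have nβ : β.Nodup := (List.nodup_cons.1 hπ.of_append_right).2
  have lα := (stackSort_perm nα).length_eq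
  have lβ := (stackSort_perm nβ).length_eq
  rw [stackSort_split hα hβ] at hs
  -- Sortedness cuts `1 2 … n` into three blocks: `S(α)` takes the lowest values and `S(β)` the next
  -- ones. This replaces an explicit use of `231`-avoidance.
  have e : List.range' 1 (α ++ n :: β).length = List.range' 1 α.length ++
      List.range' (1 + α.length) β.length ++ [1 + α.length + β.length] := by
    rw [List.range'_append_1, show [1 + α.length + β.length] =
      List.range' (1 + (α.length + β.length)) 1 by simp [add_assoc], List.range'_append_1]
    simp [add_assoc]
  rw [e] at hs
  have hs1 := (List.append_inj' hs rfl).1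
  obtain ⟨sα, sβ⟩ := List.append_inj hs1 (by simp [lα])
  have hmem : ∀ x ∈ β, α.length < x := by
    intro x hx
    have := (stackSort_perm nβ).mem_iff.2 hx
    rw [sβ] at this
    simp at this
    omega
  -- All letters of `β` exceed `|α|`, so the truncated subtraction in `mapP` loses nothing.
  obtain ⟨γ, rfl⟩ : ∃ γ : List ℕ, β = γ.map (· + α.length) := by
    refine ⟨β.map (· - α.length), ?_⟩
    rw [List.map_map]
    conv_lhs => rw [← List.map_id β]
    refine List.map_congr_left fun x hx => ?_
    have := hmem x hx
    simp; omega
  have nγ : γ.Nodup := nβ.of_map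
  have sγ : stackSort γ = List.range' 1 γ.length := by
    rw [stackSort_map_add _ nγ, List.length_map] at sβ
    apply List.map_injective_iff.2 (add_left_injective α.length)
    rw [sβ, add_comm 1, ← List.map_add_range']
    simp only [add_comm]
  rw [mapP_split hα hβ, List.map_append, List.map_cons, List.map_map, List.map_map] at hf
  obtain ⟨fα, hf⟩ := List.append_inj hf (by simp [length_mapP])
  obtain ⟨fn, fγ⟩ := List.cons.inj hf
  have e2 : (fun x => x - α.length) ∘ (fun x => x + α.length) = id := by
    funext x; simp
  rw [e2, List.map_id] at fγ
  rw [List.length_map] at fα fn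
  simp only [List.length_append, List.length_cons, List.length_map] at hn
  -- On `α`, `f` is `P(α)` raised by `|γ|`. The induction hypothesis needs the unshifted map; strict
  -- inequalities between truncated differences lift back to `f`.
  have fα' : α.map (fun x => f x - γ.length) = mapP α := by
    have := congrArg (List.map (· - γ.length)) fα
    simpa [Function.comp_def] using this
  have dα := ih α.length (by omega) nα sα fα' rfl
  have dγ := ih γ.length (by omega) nγ sγ (f := fun x => f (x + α.length)) fγ rfl
  refine respectsMax_split hα hβ ?_ dγ.of_map_add ?_ ?_
  · intro a y b hw ha hb
    obtain ⟨h1, h2⟩ := dα a y b hw ha hb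
    exact ⟨fun x hx => lt_of_tsub_lt_tsub_right (h1 x hx),
      fun x hx => lt_of_tsub_lt_tsub_right (h2 x hx)⟩
  -- On `α` the values are at most `|α| + |γ|`, and on `β` at most `|γ|`; both lie below `f n = |α|
  -- + 1 + |γ|`.
  · intro x hx
    have : f x ∈ (mapP α).map (· + γ.length) := fα ▸ List.mem_map_of_mem hx
    obtain ⟨z, hz, hzx⟩ := List.mem_map.1 this
    have := (isPermutation_mapP α).le hz
    omega
  · intro x hx
    obtain ⟨z, hz, rfl⟩ := List.mem_map.1 hx
    have : f (z + α.length) ∈ mapP γ := fγ ▸ List.mem_map_of_mem (f := f ∘ (· + α.length)) hz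
    have := (isPermutation_mapP γ).le this
    omega

/-! ### Preserved statistics -/

/-- Each subtree's reading is a factor whose root is its maximum, so relabelling cuts at the same
places. -/
theorem RespectsMax.inTree_map {f : ℕ → ℕ} {π : List ℕ} (hπ : π.Nodup) (h : RespectsMax f π) :
    inTree (π.map f) = (inTree π).map f := by
  refine split_induction (p := fun π => RespectsMax f π → inTree (π.map f) = (inTree π).map f)
    (fun _ => by simp [inTree_nil, BinaryTree.map]) ?_ hπ h
  intro α n β hα hβ eα eβ h
  have hf := h α n β List.infix_rfl hα hβ
  rw [inTree_split hα hβ, List.map_append, List.map_cons, inTree_split,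
    eα (h.of_infix ⟨[], n :: β, by simp⟩), eβ (h.of_infix ⟨α ++ [n], [], by simp⟩)]
  · rfl
  · simpa using hf.1
  · simpa using hf.2

theorem shape_map (f : ℕ → ℕ) (T : BinaryTree ℕ) : shape (T.map f) = shape T := by
  induction T with
  | nil => rfl
  | node a l r ihl ihr =>
    simp only [shape, BinaryTree.map] at *
    rw [ihl, ihr]

/-- `RespectsMax` in terms of positions. -/
theorem RespectsMax.getD_lt {f : ℕ → ℕ} {π : List ℕ} (h : RespectsMax f π) {i k j l : ℕ}
    (hik : i ≤ k) (hkj : k < j) (hj : j ≤ π.length)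
    (hmax : ∀ m, i ≤ m → m < j → m ≠ k → π.getD m 0 < π.getD k 0)
    (hil : i ≤ l) (hlj : l < j) (hlk : l ≠ k) :
    (π.map f).getD l 0 < (π.map f).getD k 0 := by
  have hk : k < π.length := by omega
  have hl : l < π.length := by omega
  -- The window of positions `[i, j)`, split around position `k`.
  have hw : ((π.take k).drop i ++ π[k] :: (π.drop (k + 1)).take (j - (k + 1))) <:+: π := by
    refine ⟨π.take i, (π.drop (k + 1)).drop (j - (k + 1)), ?_⟩
    have e1 : π.take i ++ (π.take k).drop i = π.take k := by
      conv_rhs => rw [← List.take_append_drop i (π.take k), List.take_take, min_eq_left hik]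
    rw [← List.append_assoc, e1, List.append_assoc, List.cons_append, List.take_append_drop,
      List.getElem_cons_drop, List.take_append_drop]
  have h1 : ∀ x, x ∈ (π.take k).drop i ↔ ∃ m, ∃ _ : m < k, i ≤ m ∧ π[m] = x := by
    intro x
    rw [List.mem_iff_getElem]
    constructor
    · rintro ⟨m, hm, rfl⟩
      simp at hm
      exact ⟨i + m, by omega, by omega, by simp⟩
    · rintro ⟨m, hm, him, rfl⟩
      exact ⟨m - i, by simp; omega, by simp [him]⟩
  have h2 : ∀ x, x ∈ (π.drop (k + 1)).take (j - (k + 1)) ↔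
      ∃ m, ∃ _ : m < j, k < m ∧ π[m] = x := by
    intro x
    rw [List.mem_iff_getElem]
    constructor
    · rintro ⟨m, hm, rfl⟩
      simp at hm
      exact ⟨k + 1 + m, by omega, by omega, by simp⟩
    · rintro ⟨m, hm, him, rfl⟩
      exact ⟨m - (k + 1), by simp; omega, by simp [show k + 1 + (m - (k + 1)) = m by omega]⟩
  have key := h _ _ _ hw
    (fun x hx => by
      obtain ⟨m, hm, him, rfl⟩ := (h1 x).1 hx
      have := hmax m him (by omega) (by omega)
      rwa [List.getD_eq_getElem _ _ (by omega), List.getD_eq_getElem _ _ hk] at this)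
    (fun x hx => by
      obtain ⟨m, hm, hkm, rfl⟩ := (h2 x).1 hx
      have := hmax m (by omega) hm (by omega)
      rwa [List.getD_eq_getElem _ _ (by omega), List.getD_eq_getElem _ _ hk] at this)
  rw [List.getD_eq_getElem _ _ (by simpa using hl), List.getD_eq_getElem _ _ (by simpa using hk),
    List.getElem_map, List.getElem_map]
  rcases lt_or_gt_of_ne hlk with hlt | hgt
  · exact key.1 _ ((h1 _).2 ⟨l, hlt, hil, rfl⟩)
  · exact key.2 _ ((h2 _).2 ⟨l, hlj, hgt, rfl⟩)

/-- For the converse, distinctness gives the window a strict maximum at some `m`. If `m ≠ k`, the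
relabelled letter at `m` beats the one at `k`, a contradiction; `f` need not be injective. -/
theorem RespectsMax.forall_getD_lt_iff {f : ℕ → ℕ} {π : List ℕ} (hπ : π.Nodup)
    (h : RespectsMax f π) {i k j : ℕ} (hik : i ≤ k) (hkj : k < j) (hj : j ≤ π.length) :
    (∀ l, i ≤ l → l < j → l ≠ k → (π.map f).getD l 0 < (π.map f).getD k 0) ↔
      ∀ l, i ≤ l → l < j → l ≠ k → π.getD l 0 < π.getD k 0 := by
  refine ⟨fun hf => ?_, fun hmax l hil hlj hlk => h.getD_lt hik hkj hj hmax hil hlj hlk⟩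
  obtain ⟨m, hm, hmax⟩ := (Finset.Ico i j).exists_max_image (fun l => π.getD l 0)
    ⟨k, Finset.mem_Ico.2 ⟨hik, hkj⟩⟩
  obtain ⟨him, hmj⟩ := Finset.mem_Ico.1 hm
  have hstrict : ∀ l, i ≤ l → l < j → l ≠ m → π.getD l 0 < π.getD m 0 := by
    intro l hil hlj hlm
    refine lt_of_le_of_ne (hmax l (Finset.mem_Ico.2 ⟨hil, hlj⟩)) fun e => hlm ?_
    rw [List.getD_eq_getElem _ _ (by omega), List.getD_eq_getElem _ _ (by omega)] at e
    exact (hπ.getElem_inj_iff).1 e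
  by_cases hmk : m = k
  · exact hmk ▸ hstrict
  · exact absurd (hf m him hmj hmk)
      (h.getD_lt him hmj hj hstrict hik hkj (Ne.symm hmk)).not_gt

theorem RespectsMax.lrMaxPositions_map {f : ℕ → ℕ} {π : List ℕ} (hπ : π.Nodup)
    (h : RespectsMax f π) : lrMaxPositions (π.map f) = lrMaxPositions π := by
  ext k
  simp only [lrMaxPositions, Finset.mem_filter, Finset.mem_range, List.length_map]
  refine and_congr_right fun hk => ?_
  -- A left-to-right maximum at `k` is a strict maximum of the window `[0, k + 1)`.
  have e : ∀ σ : List ℕ, (∀ l < k, σ.getD l 0 < σ.getD k 0) ↔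
      ∀ l, 0 ≤ l → l < k + 1 → l ≠ k → σ.getD l 0 < σ.getD k 0 := fun σ =>
    ⟨fun H l _ h1 h2 => H l (by omega), fun H l hl => H l (by omega) (by omega) (by omega)⟩
  rw [e, e]
  exact h.forall_getD_lt_iff hπ (Nat.zero_le k) (Nat.lt_succ_self k) hk

theorem RespectsMax.rlMaxPositions_map {f : ℕ → ℕ} {π : List ℕ} (hπ : π.Nodup)
    (h : RespectsMax f π) : rlMaxPositions (π.map f) = rlMaxPositions π := by
  ext k
  simp only [rlMaxPositions, Finset.mem_filter, Finset.mem_range, List.length_map]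
  refine and_congr_right fun hk => ?_
  -- A right-to-left maximum at `k` is a strict maximum of the window from `k` to the end.
  have e : ∀ σ : List ℕ, (∀ l < π.length, k < l → σ.getD l 0 < σ.getD k 0) ↔
      ∀ l, k ≤ l → l < π.length → l ≠ k → σ.getD l 0 < σ.getD k 0 := fun σ =>
    ⟨fun H l h1 h2 h3 => H l h2 (by omega), fun H l hl h1 => H l (by omega) hl (by omega)⟩
  rw [e, e]
  exact h.forall_getD_lt_iff hπ le_rfl hk le_rfl

/-- Only factors of length two are used: their maximum decides between `u` and `d`. -/
theorem RespectsMax.upDownWord_map {f : ℕ → ℕ} {π : List ℕ} (hπ : π.Nodup)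
    (h : RespectsMax f π) : upDownWord (π.map f) = upDownWord π := by
  induction π with
  | nil => rfl
  | cons a t ih =>
    cases t with
    | nil => rfl
    | cons b t =>
      have ih' := ih (List.nodup_cons.1 hπ).2 (h.of_infix ⟨[a], [], by simp⟩)
      simp only [upDownWord, List.map_cons, List.tail_cons, List.zipWith_cons_cons] at ih' ⊢
      rw [ih']
      congr 1
      have hab : a ≠ b := by simp at hπ; tauto
      by_cases hlt : a < b
      · have := (h [a] b [] ⟨[], t, by simp⟩ (by simpa using hlt) (by simp)).1 a (by simp)
        simp [hlt, this]
      · have := (h [] a [b] ⟨[], t, by simp⟩ (by simp) (by simp; omega)).2 b (by simp)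
        simp [hlt, this.le]

end StackSort

theorem mainTheorem4 (A : List ℕ → List ℕ) (hA : StackSort.IsComposition A)
    (n : ℕ) (θ : List ℕ) (hθ : StackSort.IsPermutation n θ)
    (hsorted : StackSort.IsSortedBy (StackSort.stackSort ∘ A) θ) :
    StackSort.IsPermutation n (StackSort.Phi A θ) ∧
    StackSort.shape (StackSort.inTree (StackSort.Phi A θ)) =
      StackSort.shape (StackSort.inTree θ) ∧
    StackSort.lrMaxPositions (StackSort.Phi A θ) = StackSort.lrMaxPositions θ ∧
    (StackSort.lrMaxPositions (StackSort.Phi A θ)).card = (StackSort.lrMaxPositions θ).card ∧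
    StackSort.rlMaxPositions (StackSort.Phi A θ) = StackSort.rlMaxPositions θ ∧
    (StackSort.rlMaxPositions (StackSort.Phi A θ)).card = (StackSort.rlMaxPositions θ).card ∧
    StackSort.upDownWord (StackSort.Phi A θ) = StackSort.upDownWord θ := by
  have hnd : θ.Nodup := hθ.nodup_iff.2 List.nodup_range'
  have hp : (A θ).Perm θ := hA.perm hnd
  have hAnd : (A θ).Nodup := hp.nodup_iff.2 hnd
  have hlen : (A θ).length = n := by simpa using (hp.trans hθ).length_eq
  have hmap := StackSort.map_relabel hAnd
  have hresp : StackSort.RespectsMax (StackSort.relabel (A θ)) θ := by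
    refine .of_isComposition hA hnd (StackSort.respectsMax_of_map_eq_mapP hAnd ?_ hmap)
    rw [hp.length_eq]
    exact hsorted
  have hl := hresp.lrMaxPositions_map hnd
  have hr := hresp.rlMaxPositions_map hnd
  refine ⟨?_, ?_, hl, congrArg _ hl, hr, congrArg _ hr, hresp.upDownWord_map hnd⟩
  -- `θ` rearranges `A(θ)`, so `Φ_A(θ)` rearranges `P(A(θ))`.
  · have h1 := StackSort.isPermutation_mapP (A θ)
    rw [hlen, ← hmap] at h1
    exact (hp.symm.map _).trans h1
  · rw [StackSort.Phi, hresp.inTree_map hnd, StackSort.shape_map]
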